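/- Let $R$ be a commutative ring which is absolutely flat (for every $r\in R$ there is $x\in R$ with $r=r^2x$) and which is not semi-artinian (that is, some non-zero quotient module $R/I$ of $R$ contains no simple submodule). Let $D(R)$ be the unbounded derived category of $R$-modules with its (derived) tensor product $\otimes$; call a full triangulated subcategory of $D(R)$, closed under isomorphisms, localising if it is closed under small coproducts, and call a localising subcategory $\mathcal{L}$ a Bousfield class if $\mathcal{L}=\ker(X\otimes -)=\{Y\in D(R) \mid X\otimes Y\cong 0\}$ for some $X\in D(R)$. Let $\mathcal{L}=\langle k(\mathfrak{p}) \mid \mathfrak{p}\in \operatorname{Spec} R\rangle$ be the smallest localising subcategory of $D(R)$ containing all the residue fields $k(\mathfrak{p})$, placed in degree $0$. Then $\mathcal{L}$ is a localising subcategory of $D(R)$ which is not of the form $\ker(X\otimes -)$ for any $X\in D(R)$. In particular not every localising subcategory of $D(R)$ is a Bousfield class, i.e. the analogue for $D(R)$ of the Hovey--Palmieri conjecture fails. -/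

import Mathlib

universe w u

open CategoryTheory CategoryTheory.Limits

/-- A commutative ring is absolutely flat (von Neumann regular) if every `r` is of the form
`r ^ 2 * x`. -/
def IsAbsolutelyFlat (R : Type u) [CommRing R] : Prop :=
  ∀ r : R, ∃ x : R, r = r ^ 2 * x

/-- A commutative ring is semi-artinian if every non-zero homomorphic image of `R` in the category
of `R`-modules (that is, every `R ⧸ I` with `I` a proper ideal) contains a simple submodule. -/
def IsSemiArtinian (R : Type u) [CommRing R] : Prop :=
  ∀ I : Ideal R, I ≠ ⊤ → ∃ N : Submodule R (R ⧸ I), IsSimpleModule R N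

/-- The tensor product (total complex) of unbounded cochain complexes of `R`-modules. -/
noncomputable abbrev tensorComplex {R : Type u} [CommRing R]
    (K L : CochainComplex (ModuleCat.{u} R) ℤ) : CochainComplex (ModuleCat.{u} R) ℤ :=
  HomologicalComplex.tensorObj K L

/-- A complex `K` is K-flat if `K ⊗ A` is acyclic for every acyclic complex `A`. -/
def IsKFlat {R : Type u} [CommRing R] (K : CochainComplex (ModuleCat.{u} R) ℤ) : Prop :=
  ∀ A : CochainComplex (ModuleCat.{u} R) ℤ, A.Acyclic → (tensorComplex K A).Acyclic

section DerivedCategory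

variable {R : Type u} [CommRing R] [HasDerivedCategory.{w} (ModuleCat.{u} R)]

/-- `Z` is (isomorphic to) the derived tensor product of `X` and `Y` in the unbounded derived
category `D(R)`: it is the tensor product of a K-flat complex `K` representing `X` with a complex
`L` representing `Y`. -/
def IsDerivedTensor (X Y Z : DerivedCategory (ModuleCat.{u} R)) : Prop :=
  ∃ K L : CochainComplex (ModuleCat.{u} R) ℤ, IsKFlat K ∧
    Nonempty (DerivedCategory.Q.obj K ≅ X) ∧ Nonempty (DerivedCategory.Q.obj L ≅ Y) ∧
    Nonempty (DerivedCategory.Q.obj (tensorComplex K L) ≅ Z)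

/-- The full subcategory `ker (X ⊗ -)` of `D(R)`, on the objects `Y` with `X ⊗ Y ≅ 0`. -/
def tensorKernel (X : DerivedCategory (ModuleCat.{u} R)) :
    ObjectProperty (DerivedCategory (ModuleCat.{u} R)) :=
  fun Y => ∃ Z, IsDerivedTensor X Y Z ∧ IsZero Z

/-- A localising subcategory of `D(R)`: a (strictly full) triangulated subcategory that is closed
under all small coproducts. -/
structure IsLocalising (P : ObjectProperty (DerivedCategory (ModuleCat.{u} R))) : Prop where
  closedUnderIso : P.IsClosedUnderIsomorphisms
  triangulated : P.IsTriangulated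
  coproducts : ∀ J : Type u, P.IsClosedUnderColimitsOfShape (Discrete J)

/-- The localising subcategory generated by a class `S` of objects of `D(R)`: the smallest
localising subcategory containing `S`. -/
def localisingClosure (S : ObjectProperty (DerivedCategory (ModuleCat.{u} R))) :
    ObjectProperty (DerivedCategory (ModuleCat.{u} R)) :=
  fun Y => ∀ P : ObjectProperty (DerivedCategory (ModuleCat.{u} R)),
    IsLocalising P → S ≤ P → P Y

/-- A Bousfield class in `D(R)` is a localising subcategory of the form `ker (X ⊗ -)`. -/
def IsBousfieldClass (P : ObjectProperty (DerivedCategory (ModuleCat.{u} R))) : Prop :=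
  IsLocalising P ∧ ∃ X : DerivedCategory (ModuleCat.{u} R), P = tensorKernel X

end DerivedCategory

section ResidueFields

variable (R : Type u) [CommRing R] [HasDerivedCategory.{w} (ModuleCat.{u} R)]

/-- The residue field `k(p)` as an object of `D(R)`, concentrated in degree `0`. -/
noncomputable def residueObj (p : PrimeSpectrum R) : DerivedCategory (ModuleCat.{u} R) :=
  (DerivedCategory.singleFunctor (ModuleCat.{u} R) 0).obj
    (ModuleCat.of R p.asIdeal.ResidueField)

/-- The localising subcategory `⟨k(p) | p ∈ Spec R⟩` of `D(R)`. -/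
def residueLocalising : ObjectProperty (DerivedCategory (ModuleCat.{u} R)) :=
  localisingClosure (fun Y => ∃ p : PrimeSpectrum R, Y = residueObj R p)

/-- The analogue for `D(R)` of the Hovey-Palmieri conjecture: every localising subcategory is a
Bousfield class. -/
def HoveyPalmieriAnalogue : Prop :=
  ∀ P : ObjectProperty (DerivedCategory (ModuleCat.{u} R)), IsLocalising P → IsBousfieldClass P

end ResidueFields

/-! ### Residue fields over an absolutely flat ring. -/

section ResidueFieldModules

variable {R : Type u} [CommRing R]

/-! Over an absolutely flat ring each `k(p)` is both simple and injective, and the `k(p)` jointly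
cogenerate the modules. Simplicity makes `⟨k(p)⟩` too small: if `R ⧸ I ≠ 0` has no simple submodule,
neither has its injective hull `E`, so no `k(p)` maps non-trivially to any shift of `E`. The left
orthogonal of these shifts is localising and contains every `k(p)` but not `E`
(`exists_not_residueLocalising`). Injectivity makes it too large for a proper Bousfield class: if
`X` kills all `k(p)`, a Künneth-type argument with functionals into `k(p)` gives `X = 0`
(`IsAbsolutelyFlat.isZero_of_tensorKernel_residueObj`), and then `ker (X ⊗ -)` is everything. -/

theorem IsAbsolutelyFlat.baer_of_field (hR : IsAbsolutelyFlat R) (k : Type*) [Field k]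
    [Algebra R k] : Module.Baer R k := by
  intro I f
  by_cases hf : f = 0
  · exact ⟨0, by simp [hf]⟩
  obtain ⟨a, ha⟩ : ∃ a, f a ≠ 0 := by
    by_contra! h
    exact hf (LinearMap.ext h)
  obtain ⟨x, hx⟩ := hR a
  have hsmul : ∀ (r : R) (b : I), f (r • b) = algebraMap R k r * f b := fun r b => by
    rw [map_smul, Algebra.smul_def]
  -- As `a = (a * x) * a`, the scalar `a * x` fixes `f a ≠ 0`, so it acts on `k` as `1`. Hence `f b
  -- = f ((a * x) • b) = b • f (x • a)`, which dictates the extension.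
  have he : algebraMap R k (a * x) = 1 := by
    have h : f a = algebraMap R k (a * x) * f a := by
      rw [← hsmul]
      congr 1
      ext
      simp only [SetLike.val_smul, smul_eq_mul]
      linear_combination hx
    exact (mul_eq_right₀ ha).1 h.symm
  refine ⟨LinearMap.toSpanSingleton R k (f (x • a)), fun b hb => ?_⟩
  have h : f (b • x • a) = f ((a * x) • ⟨b, hb⟩) := by
    congr 1
    ext
    simp only [SetLike.val_smul, smul_eq_mul]
    ring
  rw [LinearMap.toSpanSingleton_apply, ← map_smul, h, hsmul, he, one_mul]

theorem IsAbsolutelyFlat.isMaximal_of_isPrime (hR : IsAbsolutelyFlat R) (p : Ideal R)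
    [hp : p.IsPrime] : p.IsMaximal := by
  rw [Ideal.isMaximal_iff]
  refine ⟨fun h => hp.ne_top ((Ideal.eq_top_iff_one p).2 h), fun J a hpJ hap haJ => ?_⟩
  obtain ⟨x, hx⟩ := hR a
  have h : a * (1 - a * x) ∈ p := by
    have : a * (1 - a * x) = 0 := by linear_combination hx
    simp [this]
  have h1 := hpJ ((hp.mem_or_mem h).resolve_left hap)
  have h2 := J.add_mem h1 (J.mul_mem_right x haJ)
  simpa using h2

/-- Over an absolutely flat ring the residue fields cogenerate the category of modules. -/
theorem IsAbsolutelyFlat.exists_linearMap_residueField_ne_zero (hR : IsAbsolutelyFlat R)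
    {M : Type u} [AddCommGroup M] [Module R M] {x : M} (hx : x ≠ 0) :
    ∃ (p : PrimeSpectrum R) (f : M →ₗ[R] p.asIdeal.ResidueField), f x ≠ 0 := by
  let s := LinearMap.toSpanSingleton R M x
  have hs : LinearMap.ker s ≠ ⊤ := fun h => hx (by
    have : (1 : R) ∈ LinearMap.ker s := by rw [h]; trivial
    simpa [s] using this)
  -- With `m` containing the annihilator of `x`, the map `R x → k(m)`, `x ↦ 1`, is well defined;
  -- injectivity of `k(m)` extends it to `M`.
  obtain ⟨m, hm, hle⟩ := Ideal.exists_le_maximal _ hs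
  let p : PrimeSpectrum R := ⟨m, hm.isPrime⟩
  let i : (R ⧸ LinearMap.ker s) →ₗ[R] M := (LinearMap.ker s).liftQ s le_rfl
  let g : (R ⧸ LinearMap.ker s) →ₗ[R] p.asIdeal.ResidueField :=
    (LinearMap.ker s).liftQ (Algebra.linearMap R _) (fun r hr => by
      have : r ∈ p.asIdeal := hle hr
      simpa using this)
  have hi : Function.Injective i := LinearMap.ker_eq_bot.1 (Submodule.ker_liftQ_eq_bot _ _ _ le_rfl)
  obtain ⟨f, hf⟩ := (hR.baer_of_field p.asIdeal.ResidueField).extension_property i hi g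
  refine ⟨p, f, ?_⟩
  have h := LinearMap.congr_fun hf (Submodule.Quotient.mk 1)
  have h1 : i (Submodule.Quotient.mk 1) = x :=
    ((LinearMap.ker s).liftQ_apply s 1).trans (one_smul R x)
  have h2 : g (Submodule.Quotient.mk 1) = 1 :=
    ((LinearMap.ker s).liftQ_apply _ 1).trans (map_one (algebraMap R _))
  rw [LinearMap.comp_apply, h1, h2] at h
  simp [h]

end ResidueFieldModules

/-! ### Injective hulls by double complements. -/

section InjectiveHull

variable {R : Type u} [CommRing R]

/-- A submodule that is maximal among those meeting `M` trivially. -/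
theorem Submodule.exists_maximal_disjoint {J : Type*} [AddCommGroup J] [Module R J]
    (M C : Submodule R J) (h : Disjoint C M) :
    ∃ N, C ≤ N ∧ Maximal (fun N => Disjoint N M) N := by
  refine zorn_le_nonempty₀ {N | Disjoint N M} (fun c hc hchain N hN => ⟨sSup c, ?_, fun N hN =>
    le_sSup hN⟩) C h
  rw [Set.mem_ofPred_eq, Submodule.disjoint_def]
  intro x hx hxM
  obtain ⟨N', hN', hxN'⟩ :=
    (Submodule.mem_sSup_of_directed ⟨N, hN⟩ hchain.directedOn).1 hx
  exact (Submodule.disjoint_def.1 (hc hN')) x hxN' hxM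

/-- Every submodule of a Baer module is essential in a submodule which is again Baer. -/
theorem Module.Baer.exists_essential_le {J : Type u} [AddCommGroup J] [Module R J]
    (hJ : Module.Baer R J) (M : Submodule R J) :
    ∃ C : Submodule R J, M ≤ C ∧ Module.Baer R C ∧
      ∀ D : Submodule R J, D ≤ C → Disjoint D M → D = ⊥ := by
  obtain ⟨N, -, hN⟩ := Submodule.exists_maximal_disjoint M ⊥ disjoint_bot_left
  obtain ⟨C, hMC, hC⟩ := Submodule.exists_maximal_disjoint N M hN.prop.symm
  refine ⟨C, hMC, ?_, fun D hDC hDM => ?_⟩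
  · have hi : Function.Injective (N.mkQ ∘ₗ C.subtype) := by
      rw [← LinearMap.ker_eq_bot, eq_bot_iff]
      rintro ⟨c, hc⟩ h
      have hcN : c ∈ N := by simpa using h
      simpa using Submodule.disjoint_def.1 hC.prop c hc hcN
    -- The range of `g` meets `N` trivially, so maximality of `C` puts it inside `C`. Then `g ∘ₗ
    -- N.mkQ` retracts `J` onto `C`, and `C` inherits the Baer property.
    obtain ⟨g, hg⟩ := hJ.extension_property (N.mkQ ∘ₗ C.subtype) hi C.subtype
    have hgC : ∀ c ∈ C, g (N.mkQ c) = c := fun c hc => LinearMap.congr_fun hg ⟨c, hc⟩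
    have hrange : LinearMap.range g ≤ C := by
      refine hC.le_of_ge ?_ (fun c hc => ⟨_, hgC c hc⟩)
      rw [Submodule.disjoint_def]
      rintro _ ⟨v, rfl⟩ hv
      obtain ⟨y, rfl⟩ := N.mkQ_surjective v
      have hd : Disjoint (R ∙ y ⊔ N) M → y ∈ N := fun h =>
        hN.le_of_ge h le_sup_right (Submodule.mem_sup_left (Submodule.mem_span_singleton_self y))
      have hyN : y ∈ N := by
        refine hd (Submodule.disjoint_def.2 fun x hx hxM => ?_)
        obtain ⟨a, ha, n, hn, rfl⟩ := Submodule.mem_sup.1 hx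
        obtain ⟨r, rfl⟩ := Submodule.mem_span_singleton.1 ha
        have hn0 : N.mkQ n = 0 := by simpa using hn
        have h1 := hgC _ (hMC hxM)
        rw [map_add, hn0, add_zero, map_smul, map_smul] at h1
        exact Submodule.disjoint_def.1 hC.prop _ (hMC hxM) (h1 ▸ N.smul_mem r hv)
      have : N.mkQ y = 0 := by simpa using hyN
      rw [this, map_zero]
    intro I f
    obtain ⟨F, hF⟩ := hJ I (C.subtype ∘ₗ f)
    refine ⟨(g ∘ₗ N.mkQ ∘ₗ F).codRestrict C (fun r => hrange ⟨_, rfl⟩), fun x hx => ?_⟩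
    ext
    change g (N.mkQ (F x)) = _
    rw [hF x hx]
    exact hgC _ (f ⟨x, hx⟩).2
  · have hDN : Disjoint D N := hC.prop.mono_left hDC
    have h : Disjoint (N ⊔ D) M := by
      rw [Submodule.disjoint_def]
      intro x hx hxM
      obtain ⟨n, hn, d, hd, rfl⟩ := Submodule.mem_sup.1 hx
      have hnC : n ∈ C := by simpa using C.sub_mem (hMC hxM) (hDC hd)
      have hn0 : n = 0 := Submodule.disjoint_def.1 hC.prop n hnC hn
      subst hn0
      rw [zero_add] at hxM ⊢
      exact Submodule.disjoint_def.1 hDM d hd hxM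
    have hle : D ≤ N := le_sup_right.trans (hN.le_of_ge h le_sup_left)
    exact disjoint_self.1 (hDN.mono_right hle)

/-- Over a ring that is not semi-artinian there is a non-zero injective module without simple
submodules. -/
theorem exists_injective_forall_not_isSimpleModule (hR : ¬ IsSemiArtinian R) :
    ∃ (E : Type u) (_ : AddCommGroup E) (_ : Module R E), Module.Injective R E ∧ Nontrivial E ∧
      ∀ N : Submodule R E, ¬ IsSimpleModule R N := by
  simp only [IsSemiArtinian, not_forall, not_exists] at hR
  obtain ⟨I, hI, hsimple⟩ := hR
  have := Ideal.Quotient.nontrivial_iff.2 hI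
  let A := ModuleCat.of R (R ⧸ I)
  let ι := Injective.ι A
  have hι : Function.Injective ι.hom := (ModuleCat.mono_iff_injective ι).1 inferInstance
  have hJ : Module.Baer R (Injective.under A : ModuleCat R) :=
    Module.Baer.of_injective
      ((Module.injective_iff_injective_object R _).2 (Injective.injective_under A))
  let M := LinearMap.range ι.hom
  let e : (R ⧸ I) ≃ₗ[R] M := LinearEquiv.ofInjective ι.hom hι
  obtain ⟨C, hMC, hC, hess⟩ := hJ.exists_essential_le M
  refine ⟨C, inferInstance, inferInstance, hC.injective, ?_, fun N hN => ?_⟩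
  · have : Nontrivial M := e.symm.toEquiv.nontrivial
    exact (Submodule.inclusion_injective hMC).nontrivial
  · let D := N.map C.subtype
    have hD : IsSimpleModule R D :=
      (LinearEquiv.isSimpleModule_iff (N.equivMapOfInjective _ C.injective_subtype)).1 hN
    -- By essentiality a simple submodule of the hull meets `M ≅ R ⧸ I`, hence lies inside it.
    have hDM : ¬ Disjoint D M := fun h => by
      have h0 := hess D (Submodule.map_subtype_le C N) h
      exact (Submodule.nontrivial_iff_ne_bot.1 hD.nontrivial) h0
    have hat : IsAtom D := isSimpleModule_iff_isAtom.1 hD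
    have hle : D ≤ M := by
      rcases hat.le_iff.1 (inf_le_left : D ⊓ M ≤ D) with h | h
      · exact absurd (disjoint_iff.2 h) hDM
      · exact inf_eq_left.1 h
    let D' := D.submoduleOf M
    have hD' : IsSimpleModule R D' :=
      (LinearEquiv.isSimpleModule_iff (Submodule.submoduleOfEquivOfLe hle)).2 hD
    let F := D'.map e.symm.toLinearMap
    exact hsimple F ((LinearEquiv.isSimpleModule_iff (e.symm.submoduleMap D')).1 hD')

end InjectiveHull

/-! ### Localising subcategories and orthogonals. -/

section Localising

variable {R : Type u} [CommRing R] [HasDerivedCategory.{w} (ModuleCat.{u} R)]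

theorem isLocalising_localisingClosure (S : ObjectProperty (DerivedCategory (ModuleCat.{u} R))) :
    IsLocalising (localisingClosure S) where
  closedUnderIso := ⟨fun e hX P hP hS => by
    have := hP.closedUnderIso
    exact P.prop_of_iso e (hX P hP hS)⟩
  triangulated :=
    { exists_zero := ⟨_, isZero_zero _, fun P hP _ => by
        have := hP.closedUnderIso
        have := hP.triangulated
        exact P.prop_zero⟩
      isStableUnderShiftBy := fun n => ⟨fun X hX P hP hS => by
        have := hP.triangulated
        exact P.le_shift n _ (hX P hP hS)⟩
      ext₂' := fun T hT h₁ h₃ => ObjectProperty.le_isoClosure _ _ fun P hP hS => by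
        have := hP.closedUnderIso
        have := hP.triangulated
        exact P.ext_of_isTriangulatedClosed₂ T hT (h₁ P hP hS) (h₃ P hP hS) }
  coproducts J := ⟨by
    rintro X ⟨h⟩ P hP hS
    have := hP.coproducts J
    exact P.prop_of_isColimit h.isColimit fun j => h.prop_diag_obj j P hP hS⟩

theorem isLocalising_leftOrthogonal (S : ObjectProperty (DerivedCategory (ModuleCat.{u} R)))
    [S.IsStableUnderShift ℤ] : IsLocalising S.leftOrthogonal where
  closedUnderIso := inferInstance
  triangulated := inferInstance
  coproducts J := ⟨by
    rintro X ⟨h⟩ Y f hY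
    refine h.isColimit.hom_ext fun j => ?_
    rw [comp_zero]
    exact h.prop_diag_obj j _ hY⟩

end Localising

namespace DerivedCategory

variable {C : Type*} [Category* C] [Abelian C] [HasDerivedCategory.{w} C]

/-- The objects of the derived category that are shifts of a given object of the heart. -/
def isShiftOfSingle (E : C) : ObjectProperty (DerivedCategory C) :=
  fun Y => ∃ n : ℤ, Nonempty (Y ≅ (singleFunctor C n).obj E)

instance (E : C) : (isShiftOfSingle E).IsStableUnderShift ℤ where
  isStableUnderShiftBy a := ⟨by
    rintro Y ⟨n, ⟨e⟩⟩
    exact ⟨n - a, ⟨(shiftFunctor (DerivedCategory C) a).mapIso e ≪≫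
      ((singleFunctors C).shiftIso a (n - a) n (by lia)).app E⟩⟩⟩

/-- There are no non-zero maps of any degree from `A` to an injective object `E` as soon as there
are none in degree zero. -/
theorem leftOrthogonal_isShiftOfSingle_of_injective {A E : C} [Injective E]
    (h : ∀ f : A ⟶ E, f = 0) (m : ℤ) :
    (isShiftOfSingle E).leftOrthogonal ((singleFunctor C m).obj A) := by
  rintro Y f ⟨n, ⟨e⟩⟩
  rw [← cancel_mono e.hom, zero_comp]
  generalize f ≫ e.hom = g
  -- The map is a class in `Ext^(m - n)(A, E)`: positive degrees vanish by injectivity, degree zero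
  -- by `h`, negative degrees by the t-structure.
  rcases lt_trichotomy n m with hn | rfl | hn
  · exact to_singleFunctor_obj_eq_zero_of_injective
      (K := (CochainComplex.singleFunctor C m).obj A) g m hn
  · obtain ⟨g', rfl⟩ := (singleFunctor C n).map_surjective g
    rw [h g', Functor.map_zero]
  · exact TStructure.t.zero_of_isLE_of_isGE g m n hn inferInstance inferInstance

theorem not_leftOrthogonal_isShiftOfSingle {E : C} (hE : ¬ IsZero E) (n : ℤ) :
    ¬ (isShiftOfSingle E).leftOrthogonal ((singleFunctor C n).obj E) := fun h => by
  have h0 : 𝟙 ((singleFunctor C n).obj E) = 0 := h _ ⟨n, ⟨Iso.refl _⟩⟩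
  apply hE
  rw [IsZero.iff_id_eq_zero]
  apply (singleFunctor C n).map_injective
  rw [CategoryTheory.Functor.map_id, h0, CategoryTheory.Functor.map_zero]

end DerivedCategory

/-! ### The residue fields do not generate. -/

section Residue

variable {R : Type u} [CommRing R]

theorem IsAbsolutelyFlat.isSimpleModule_residueField (hR : IsAbsolutelyFlat R)
    (p : PrimeSpectrum R) : IsSimpleModule R p.asIdeal.ResidueField := by
  have := hR.isMaximal_of_isPrime p.asIdeal
  have hs : Function.Surjective (Algebra.linearMap R p.asIdeal.ResidueField) :=
    p.asIdeal.algebraMap_residueField_surjective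
  have hker : LinearMap.ker (Algebra.linearMap R p.asIdeal.ResidueField) = p.asIdeal := by
    ext r
    simp
  have : IsSimpleModule R (R ⧸ p.asIdeal) := isSimpleModule_iff_isCoatom.2 this.out
  rw [← hker] at this
  exact (LinearEquiv.isSimpleModule_iff
    ((Algebra.linearMap R p.asIdeal.ResidueField).quotKerEquivOfSurjective hs)).1 this

theorem LinearMap.eq_zero_of_forall_not_isSimpleModule {k E : Type*} [AddCommGroup k] [Module R k]
    [IsSimpleModule R k] [AddCommGroup E] [Module R E]
    (hE : ∀ N : Submodule R E, ¬ IsSimpleModule R N) (f : k →ₗ[R] E) : f = 0 := by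
  refine (f.injective_or_eq_zero).resolve_left fun hf => hE (LinearMap.range f) ?_
  exact (LinearEquiv.isSimpleModule_iff (LinearEquiv.ofInjective f hf)).1 inferInstance

/-- Over an absolutely flat ring that is not semi-artinian, the residue fields do not generate the
derived category. -/
theorem exists_not_residueLocalising [HasDerivedCategory.{w} (ModuleCat.{u} R)]
    (hflat : IsAbsolutelyFlat R) (hsa : ¬ IsSemiArtinian R) :
    ∃ Y, ¬ residueLocalising R Y := by
  obtain ⟨E, _, _, hinj, hnt, hE⟩ := exists_injective_forall_not_isSimpleModule hsa
  have : Injective (ModuleCat.of R E) := Module.injective_object_of_injective_module R E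
  refine ⟨(DerivedCategory.singleFunctor _ 0).obj (ModuleCat.of R E), fun h => ?_⟩
  refine DerivedCategory.not_leftOrthogonal_isShiftOfSingle
    (fun h0 => not_subsingleton E (ModuleCat.subsingleton_of_isZero h0)) 0
    (h _ (isLocalising_leftOrthogonal _) ?_)
  rintro _ ⟨p, rfl⟩
  have := hflat.isSimpleModule_residueField p
  exact DerivedCategory.leftOrthogonal_isShiftOfSingle_of_injective
    (fun f => ModuleCat.hom_ext (LinearMap.eq_zero_of_forall_not_isSimpleModule hE f.hom)) 0

end Residue

/-! ### Detecting cohomology of tensor products. -/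

section Kuenneth

variable {R : Type u} [CommRing R]

/-- A functional on one term of a complex that kills the boundaries, extended by zero to all
terms. -/
theorem exists_functionals_of_d_comp_eq_zero {C : Type*} [Category* C] [Abelian C]
    (K : CochainComplex C ℤ) {A : C} (n : ℤ) (f : K.X n ⟶ A) (hf : K.d (n - 1) n ≫ f = 0) :
    ∃ α : ∀ i, K.X i ⟶ A, α n = f ∧ ∀ i j, K.d i j ≫ α j = 0 := by
  refine ⟨fun i => if h : i = n then (K.XIsoOfEq h).hom ≫ f else 0, by simp, fun i j => ?_⟩
  by_cases hj : j = n
  · subst hj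
    by_cases hi : i = j - 1
    · subst hi
      simpa using hf
    · rw [K.shape _ _ (fun h => hi (by simp at h; lia)), zero_comp]
  · simp [hj]

open MonoidalCategory in
/-- Functionals on two complexes that kill the boundaries and do not vanish on cocycles `x` and `z`
show that `x ⊗ z` is not a boundary. -/
theorem not_exactAt_tensorComplex (K L : CochainComplex (ModuleCat.{u} R) ℤ) (k : Type u) [Field k]
    [Algebra R k] (α : ∀ i, K.X i ⟶ ModuleCat.of R k) (β : ∀ i, L.X i ⟶ ModuleCat.of R k)
    (hα : ∀ i j, K.d i j ≫ α j = 0) (hβ : ∀ i j, L.d i j ≫ β j = 0) {m n : ℤ}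
    {x : K.X m} {z : L.X n} (hx : K.d m (m + 1) x = 0) (hz : L.d n (n + 1) z = 0)
    (hαx : α m x ≠ 0) (hβz : β n z ≠ 0) :
    ¬ (tensorComplex K L).ExactAt (m + n) := by
  intro hex
  -- The products `α a * β b` kill the two parts of the total differential separately, so the signs
  -- play no role.
  let B (i j : ℤ) : K.X i ⊗ L.X j ⟶ ModuleCat.of R k :=
    ModuleCat.ofHom (TensorProduct.lift ((LinearMap.mul R k).compl₁₂ (α i).hom (β j).hom))
  have hB₁ (i i' j : ℤ) : (K.d i i' ▷ L.X j) ≫ B i' j = 0 := by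
    refine ModuleCat.MonoidalCategory.tensor_ext fun a b => ?_
    have h : α i' (K.d i i' a) = 0 := ConcreteCategory.congr_hom (hα i i') a
    change α i' (K.d i i' a) * β j b = 0
    rw [h, zero_mul]
  have hB₂ (i j j' : ℤ) : (K.X i ◁ L.d j j') ≫ B i j' = 0 := by
    refine ModuleCat.MonoidalCategory.tensor_ext fun a b => ?_
    have h : β j' (L.d j j' b) = 0 := ConcreteCategory.congr_hom (hβ j j') b
    change α i a * β j' (L.d j j' b) = 0
    rw [h, mul_zero]
  let Θ (l : ℤ) : (tensorComplex K L).X l ⟶ ModuleCat.of R k :=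
    HomologicalComplex.mapBifunctorDesc fun i j _ => B i j
  have hΘ (l l' : ℤ) (hl : l + 1 = l') : (tensorComplex K L).d l l' ≫ Θ l' = 0 := by
    refine HomologicalComplex.mapBifunctor.hom_ext fun i j h => ?_
    have h' : i + j = l := h
    rw [HomologicalComplex.mapBifunctor.d_eq, Preadditive.add_comp, Preadditive.comp_add,
      HomologicalComplex.mapBifunctor.ι_D₁_assoc, HomologicalComplex.mapBifunctor.ι_D₂_assoc,
      HomologicalComplex.mapBifunctor.d₁_eq K L _ _ (i₁' := i + 1) (by simp) j l'
        (by change i + 1 + j = l'; lia),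
      HomologicalComplex.mapBifunctor.d₂_eq K L _ _ i (i₂' := j + 1) (by simp) l'
        (by change i + (j + 1) = l'; lia),
      Linear.units_smul_comp, Linear.units_smul_comp, Category.assoc, Category.assoc,
      HomologicalComplex.ι_mapBifunctorDesc, HomologicalComplex.ι_mapBifunctorDesc, comp_zero]
    erw [hB₁, hB₂]
    simp
  let ι := HomologicalComplex.ιTensorObj K L m n (m + n) rfl
  let t : (K.X m ⊗ L.X n : ModuleCat R) := x ⊗ₜ[R] z
  have ht : (tensorComplex K L).d (m + n) (m + n + 1) (ι t) = 0 := by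
    have h₁ : (K.d m (m + 1) ▷ L.X n) t = 0 := by
      change (K.d m (m + 1) x) ⊗ₜ[R] z = 0
      rw [hx, TensorProduct.zero_tmul]
    have h₂ : (K.X m ◁ L.d n (n + 1)) t = 0 := by
      change x ⊗ₜ[R] (L.d n (n + 1) z) = 0
      rw [hz, TensorProduct.tmul_zero]
    have h : ι ≫ (tensorComplex K L).d (m + n) (m + n + 1) =
        ComplexShape.ε₁ (.up ℤ) (.up ℤ) (.up ℤ) (m, n) • ((K.d m (m + 1) ▷ L.X n) ≫
          HomologicalComplex.ιTensorObj K L (m + 1) n (m + n + 1) (by lia)) +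
        ComplexShape.ε₂ (.up ℤ) (.up ℤ) (.up ℤ) (m, n) • ((K.X m ◁ L.d n (n + 1)) ≫
          HomologicalComplex.ιTensorObj K L m (n + 1) (m + n + 1) (by lia)) := by
      rw [HomologicalComplex.mapBifunctor.d_eq, Preadditive.comp_add,
        HomologicalComplex.mapBifunctor.ι_D₁, HomologicalComplex.mapBifunctor.ι_D₂,
        HomologicalComplex.mapBifunctor.d₁_eq K L _ _ (i₁' := m + 1) (by simp) n (m + n + 1)
          (by change m + 1 + n = m + n + 1; lia),
        HomologicalComplex.mapBifunctor.d₂_eq K L _ _ m (i₂' := n + 1) (by simp) (m + n + 1)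
          (by change m + (n + 1) = m + n + 1; lia)]
      rfl
    have h' := ConcreteCategory.congr_hom h t
    rw [ConcreteCategory.comp_apply] at h'
    rw [h', Units.smul_def, Units.smul_def]
    simp [h₁, h₂]
  rw [HomologicalComplex.exactAt_iff' _ (m + n - 1) (m + n) (m + n + 1) (by simp) (by simp),
    ShortComplex.moduleCat_exact_iff] at hex
  obtain ⟨y, hy⟩ := hex (ι t) ht
  -- Exactness makes the cocycle `x ⊗ z` a boundary, on which `Θ` vanishes; yet its value there is
  -- `α x * β z ≠ 0`.
  have h₀ : Θ (m + n) (ι t) = 0 := by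
    rw [← hy]
    exact ConcreteCategory.congr_hom (hΘ (m + n - 1) (m + n) (by lia)) y
  have hι : ι ≫ Θ (m + n) = B m n := HomologicalComplex.ι_mapBifunctorDesc _ m n rfl
  have h₁ : Θ (m + n) (ι t) = α m x * β n z := ConcreteCategory.congr_hom hι t
  exact mul_ne_zero hαx hβz (h₁.symm.trans h₀)

/-- A non-zero map from a cohomology module to a field extends to a functional on the cochains. -/
theorem IsAbsolutelyFlat.exists_functionals (hR : IsAbsolutelyFlat R)
    (L : CochainComplex (ModuleCat.{u} R) ℤ) {n : ℤ} (k : Type u) [Field k] [Algebra R k]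
    {g : L.homology n ⟶ ModuleCat.of R k} (hg : g ≠ 0) :
    ∃ (β : ∀ i, L.X i ⟶ ModuleCat.of R k) (z : L.X n),
      (∀ i j, L.d i j ≫ β j = 0) ∧ L.d n (n + 1) z = 0 ∧ β n z ≠ 0 := by
  have hi : Function.Injective (L.iCycles n).hom :=
    (ModuleCat.mono_iff_injective (L.iCycles n)).1 inferInstance
  -- Injectivity of `k` extends the functional from cocycles to cochains; coming from cohomology, it
  -- kills boundaries.
  obtain ⟨f, hf⟩ := (hR.baer_of_field k).extension_property (L.iCycles n).hom hi
    (L.homologyπ n ≫ g).hom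
  have hf' : L.iCycles n ≫ ModuleCat.ofHom f = L.homologyπ n ≫ g := ModuleCat.hom_ext hf
  obtain ⟨z, hz⟩ : ∃ z, (L.homologyπ n ≫ g) z ≠ 0 := by
    by_contra! h
    refine hg ?_
    rw [← cancel_epi (L.homologyπ n), comp_zero]
    ext z
    exact h z
  obtain ⟨β, hβn, hβ⟩ := exists_functionals_of_d_comp_eq_zero L n (ModuleCat.ofHom f) (by
    rw [← L.toCycles_i, Category.assoc, hf', L.toCycles_comp_homologyπ_assoc, zero_comp])
  refine ⟨β, L.iCycles n z, hβ, ?_, ?_⟩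
  · rw [← ConcreteCategory.comp_apply, L.iCycles_d]
    rfl
  · rwa [hβn, ← ConcreteCategory.comp_apply, hf']

end Kuenneth

/-! ### Objects killed by all residue fields. -/

section TensorKernel

theorem DerivedCategory.isZero_Q_obj_iff {C : Type*} [Category* C] [Abelian C]
    [HasDerivedCategory.{w} C] (K : CochainComplex C ℤ) :
    IsZero (DerivedCategory.Q.obj K) ↔ K.Acyclic := by
  refine ⟨fun h n => ?_, fun h => ?_⟩
  · rw [HomologicalComplex.exactAt_iff_isZero_homology]
    exact ((DerivedCategory.homologyFunctor C n).map_isZero h).of_iso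
      ((DerivedCategory.homologyFunctorFactors C n).symm.app K)
  -- On an acyclic complex the zero endomorphism is a quasi-isomorphism, so it becomes invertible in
  -- the derived category.
  · have : QuasiIso (0 : K ⟶ K) :=
      ⟨fun n => by
        rw [quasiIsoAt_iff_isIso_homologyMap]
        exact isIso_of_source_target_iso_zero _ (h n).isZero_homology.isoZero
          (h n).isZero_homology.isoZero⟩
    have h0 : IsIso (DerivedCategory.Q.map (0 : K ⟶ K)) := inferInstance
    rw [Functor.map_zero] at h0
    exact (isZero_zero _).of_iso (isIsoZeroEquivIsoZero _ _ h0).1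

theorem isZero_tensorComplex {R : Type u} [CommRing R]
    {K : CochainComplex (ModuleCat.{u} R) ℤ} (hK : IsZero K)
    (L : CochainComplex (ModuleCat.{u} R) ℤ) : IsZero (tensorComplex K L) := by
  rw [IsZero.iff_id_eq_zero]
  ext1 l
  refine HomologicalComplex.mapBifunctor.hom_ext fun i j h => IsZero.eq_of_src ?_ _ _
  have hi : IsZero (K.X i) := (HomologicalComplex.eval _ _ i).map_isZero hK
  exact ((MonoidalCategory.curriedTensor (ModuleCat.{u} R)).flip.obj (L.X j)).map_isZero hi

variable {R : Type u} [CommRing R] [HasDerivedCategory.{w} (ModuleCat.{u} R)]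

/-- Over an absolutely flat ring, an object of the derived category that is annihilated by all
residue fields is zero. -/
theorem IsAbsolutelyFlat.isZero_of_tensorKernel_residueObj (hR : IsAbsolutelyFlat R)
    {X : DerivedCategory (ModuleCat.{u} R)} (hX : ∀ p, tensorKernel X (residueObj R p)) :
    IsZero X := by
  let K₀ := DerivedCategory.Q.objPreimage X
  let e₀ : DerivedCategory.Q.obj K₀ ≅ X := DerivedCategory.Q.objObjPreimageIso X
  refine IsZero.of_iso ((DerivedCategory.isZero_Q_obj_iff K₀).2 fun n => ?_) e₀.symm
  by_contra hn
  rw [HomologicalComplex.exactAt_iff_isZero_homology] at hn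
  obtain ⟨c, hc⟩ : ∃ c : K₀.homology n, c ≠ 0 := by
    by_contra! h
    exact hn (@ModuleCat.isZero_of_subsingleton _ _ _ ⟨fun a b => (h a).trans (h b).symm⟩)
  obtain ⟨p, f, hf⟩ := hR.exists_linearMap_residueField_ne_zero hc
  obtain ⟨Z, ⟨K, L, -, ⟨eK⟩, ⟨eL⟩, ⟨eZ⟩⟩, hZ⟩ := hX p
  let F (i : ℤ) := DerivedCategory.homologyFunctorFactors (ModuleCat.{u} R) i
  let uK : K.homology n ≅ K₀.homology n :=
    (F n).symm.app K ≪≫ (DerivedCategory.homologyFunctor _ n).mapIso (eK ≪≫ e₀.symm) ≪≫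
      (F n).app K₀
  let uL : L.homology 0 ≅ ModuleCat.of R p.asIdeal.ResidueField :=
    (F 0).symm.app L ≪≫ (DerivedCategory.homologyFunctor _ 0).mapIso eL ≪≫
      (DerivedCategory.singleFunctorCompHomologyFunctorIso _ 0).app _
  have hf' : ModuleCat.ofHom f ≠ 0 := fun h => hf (ConcreteCategory.congr_hom h c)
  have huK : uK.hom ≫ ModuleCat.ofHom f ≠ 0 := fun h => hf' (by
    rwa [← cancel_epi uK.hom, comp_zero])
  have huL : uL.hom ≠ 0 := fun h => by
    have h1 : 𝟙 (ModuleCat.of R p.asIdeal.ResidueField) = 0 := by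
      rw [← uL.inv_hom_id, h, comp_zero]
    exact one_ne_zero (ConcreteCategory.congr_hom h1 (1 : p.asIdeal.ResidueField))
  obtain ⟨α, x, hα, hx, hαx⟩ := hR.exists_functionals K _ huK
  obtain ⟨β, z, hβ, hz, hβz⟩ := hR.exists_functionals L _ huL
  exact not_exactAt_tensorComplex K L _ α β hα hβ hx hz hαx hβz
    ((DerivedCategory.isZero_Q_obj_iff _).1 (hZ.of_iso eZ) _)

/-- The zero complex is a K-flat representative of `X`, and its tensor product with any complex is
zero. -/
theorem tensorKernel_of_isZero {X : DerivedCategory (ModuleCat.{u} R)} (hX : IsZero X)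
    (Y : DerivedCategory (ModuleCat.{u} R)) : tensorKernel X Y := by
  have h0 : IsZero (HomologicalComplex.zero : CochainComplex (ModuleCat.{u} R) ℤ) :=
    HomologicalComplex.isZero_zero
  have hQ {K : CochainComplex (ModuleCat.{u} R) ℤ} (hK : IsZero K) :
      IsZero (DerivedCategory.Q.obj K) := DerivedCategory.Q.map_isZero hK
  refine ⟨_, ⟨HomologicalComplex.zero, DerivedCategory.Q.objPreimage Y, fun A _ n => ?_,
    ⟨(hQ h0).iso hX⟩, ⟨DerivedCategory.Q.objObjPreimageIso Y⟩, ⟨Iso.refl _⟩⟩,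
    hQ (isZero_tensorComplex h0 _)⟩
  exact HomologicalComplex.ExactAt.of_isZero
    ((HomologicalComplex.eval _ _ n).map_isZero (isZero_tensorComplex h0 A))

end TensorKernel

theorem mainTheorem4 (R : Type u) [CommRing R] [HasDerivedCategory.{w} (ModuleCat.{u} R)]
    (hflat : IsAbsolutelyFlat R) (hsa : ¬ IsSemiArtinian R) :
    IsLocalising (residueLocalising R) ∧
      (∀ X : DerivedCategory (ModuleCat.{u} R), residueLocalising R ≠ tensorKernel X) ∧
      ¬ HoveyPalmieriAnalogue R := by
  have hne (X : DerivedCategory (ModuleCat.{u} R)) : residueLocalising R ≠ tensorKernel X := by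
    intro h
    obtain ⟨Y, hY⟩ := exists_not_residueLocalising hflat hsa
    refine hY (h ▸ tensorKernel_of_isZero
      (hflat.isZero_of_tensorKernel_residueObj fun p => ?_) Y)
    rw [← h]
    exact fun P _ hP => hP _ ⟨p, rfl⟩
  refine ⟨isLocalising_localisingClosure _, hne, fun H => ?_⟩
  obtain ⟨-, X, hX⟩ := H _ (isLocalising_localisingClosure _)
  exact hne X hX
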